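/- Let $q,m\ge 0$ be integers, write $[q]=\{1,\dots,q\}$, let $W\subseteq[q]^m$, and consider the shift of finite type $$S=S(q,m,W)=\{x\in[q]^{\mathbb Z} : (x_{i+1},\dots,x_{i+m})\in W \text{ for all } i\in\mathbb Z\}.$$ For $w\in W$ let $T(w)$ be the set of integers $t\ge 1$ for which some $x\in S$ satisfies $(x_1,\dots,x_m)=(x_{t+1},\dots,x_{t+m})=w$. The shift $S$ is called non-lattice if for some $w\in W$ the set $T(w)$ has greatest common divisor $1$. A process $X=(X_i)_{i\in\mathbb Z}$ is stationary if $(X_i)_{i\in\mathbb Z}$ and $(X_{i+1})_{i\in\mathbb Z}$ are equal in law. It is $k$-dependent if $(\dots,X_{i-2},X_{i-1})$ and $(X_{i+k},X_{i+k+1},\dots)$ are independent for each $i\in\mathbb Z$. It is an $r$-block-factor if it is equal in law to $(f(U_{i+1},\dots,U_{i+r}))_{i\in\mathbb Z}$ for some i.i.d. sequence $(U_i)_{i\in\mathbb Z}$, with values in some measurable space, and some measurable $f$. 1. If $S$ is non-lattice, then there exist an integer $k\ge 0$ (depending on $S$) and a stationary $k$-dependent process $X$ such that $X\in S$ almost surely.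 2. If $S$ contains no constant sequence, then for every $r\ge 0$ no $r$-block-factor belongs to $S$ almost surely. In particular, for every non-lattice shift of finite type $S$ on $\mathbb Z$ that contains no constant sequence, some stationary finitely dependent process belongs to $S$ almost surely, but no block-factor does. -/

import Mathlib

open MeasureTheory ProbabilityTheory

universe u v w

namespace SFT

/-- The pattern `(x_{i+1}, …, x_{i+m})` seen in the bi-infinite sequence `x`. -/
def window {A : Type*} (x : ℤ → A) (i : ℤ) (m : ℕ) : Fin m → A :=
  fun j => x (i + 1 + (j : ℤ))

/-- The shift of finite type `S(q, m, W)` on `ℤ`; the alphabet `[q]` is `Fin q`. -/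
def shift (q m : ℕ) (W : Set (Fin m → Fin q)) : Set (ℤ → Fin q) :=
  {x | ∀ i : ℤ, window x i m ∈ W}

/-- The set `T(w)` of times `t ≥ 1` at which the pattern `w` can recur. -/
def recurrenceTimes (q m : ℕ) (W : Set (Fin m → Fin q)) (w : Fin m → Fin q) : Set ℕ :=
  {t | 1 ≤ t ∧ ∃ x ∈ shift q m W, window x 0 m = w ∧ window x (t : ℤ) m = w}

/-- Non-lattice: for some allowed pattern `w`, the greatest common divisor of `T(w)` is `1`. -/
def NonLattice (q m : ℕ) (W : Set (Fin m → Fin q)) : Prop :=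
  ∃ w ∈ W, Nat.setGcd (recurrenceTimes q m W w) = 1

section Processes

variable {Ω : Type u} {A : Type v} [MeasurableSpace Ω] [MeasurableSpace A]

/-- `(X_i)_{i ∈ ℤ}` and `(X_{i+1})_{i ∈ ℤ}` are equal in law. -/
def IsStationary (X : ℤ → Ω → A) (P : Measure Ω) : Prop :=
  IdentDistrib (fun ω (i : ℤ) => X i ω) (fun ω (i : ℤ) => X (i + 1) ω) P P

/-- For each `i`, the sequences `(…, X_{i-2}, X_{i-1})` and `(X_{i+k}, X_{i+k+1}, …)` are
independent of each other. -/
def IsKDependent (k : ℕ) (X : ℤ → Ω → A) (P : Measure Ω) : Prop :=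
  ∀ i : ℤ, IndepFun (fun ω (j : {j : ℤ // j < i}) => X j ω)
    (fun ω (j : {j : ℤ // i + k ≤ j}) => X j ω) P

end Processes

/-- `X` is, in law, an `r`-block-factor of an i.i.d. process: there are i.i.d. random variables
`(U_i)_{i ∈ ℤ}`, with values in any measurable space `E` and defined on any probability space, and
a measurable `f` such that `X` has the law of `(f(U_{i+1}, …, U_{i+r}))_{i ∈ ℤ}`. -/
def IsBlockFactor {Ω : Type u} [MeasurableSpace Ω] {q : ℕ} (r : ℕ) (X : ℤ → Ω → Fin q)
    (P : Measure Ω) : Prop :=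
  ∃ (Ω' : Type v) (_ : MeasurableSpace Ω') (P' : Measure Ω') (_ : IsProbabilityMeasure P')
    (E : Type w) (_ : MeasurableSpace E) (U : ℤ → Ω' → E) (f : (Fin r → E) → Fin q),
    (∀ i, Measurable (U i)) ∧ iIndepFun U P' ∧ (∀ i, IdentDistrib (U i) (U 0) P' P') ∧
    Measurable f ∧
    IdentDistrib (fun ω (i : ℤ) => X i ω)
      (fun ω' (i : ℤ) => f (window (fun j : ℤ => U j ω') i r)) P P'

end SFT

/-! For the first part, a 1-dependent proper 4-colouring of `ℤ` (Holroyd and Liggett) is transformed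
by a local rule. A word x of length n gets probability B(x) / (2^n (n+1)!), where B(x) counts the
ways to build x letter by letter through proper words. With four colours, `sum_buildings` makes
these weights both consistent and 1-dependent (`sum_wordProb`).

Interleaving independent copies, d + 1 rows for each d < N, yields 4^N colours such that points at
distance at most N differ (`interleave_ne`). A greedy selection then marks points with all gaps
between N + 1 and 2N + 1. Since T(w) is closed under addition and has gcd 1, w recurs after every
large time t, so each gap can be filled by a piece of an element of S leading from w to w
(`fill_mem_shift`). All of this has bounded range, so finite dependence survives.

The second part is a Ramsey argument. Colour r-tuples of indices by the value of f on the
corresponding variables. For every outcome, some long injective sequence of indices has all its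
r-segments of one colour (`exists_injective_segments_eq`). There are countably many such sequences,
so one of these events has positive probability, and by `measure_preimage_reindex` the indices may
be taken consecutive. Thus the block-factor shows a constant pattern with positive probability, but
no constant pattern lies in W. -/

namespace SFT

/-! ### Counting proper buildings of words. -/

/-- The sum of `f` over the words obtained from a word by deleting one letter. -/
def deletionSum {A : Type*} (f : List A → ℕ) : List A → ℕ
  | [] => 0
  | a :: x => f x + deletionSum (fun l => f (a :: l)) x

section DeletionSum

variable {A : Type*}

theorem deletionSum_append (f : List A → ℕ) (x y : List A) :
    deletionSum f (x ++ y) =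
      deletionSum (fun l => f (l ++ y)) x + deletionSum (fun l => f (x ++ l)) y := by
  induction x generalizing f with
  | nil => simp [deletionSum]
  | cons a x ih => simp [deletionSum, ih, add_assoc]

theorem deletionSum_congr {f g : List A → ℕ} {x : List A}
    (h : ∀ l : List A, l.length + 1 = x.length → f l = g l) :
    deletionSum f x = deletionSum g x := by
  induction x generalizing f g with
  | nil => rfl
  | cons a x ih =>
    simp only [deletionSum]
    rw [h x rfl, ih fun l hl => h _ (by simpa using hl)]

theorem deletionSum_zero (x : List A) : deletionSum (fun _ => 0) x = 0 := by
  induction x with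
  | nil => rfl
  | cons a x ih => simpa [deletionSum] using ih

theorem deletionSum_mul (c : ℕ) (f : List A → ℕ) (x : List A) :
    deletionSum (fun l => c * f l) x = c * deletionSum f x := by
  induction x generalizing f with
  | nil => rfl
  | cons a x ih => simp [deletionSum, ih, mul_add]

theorem deletionSum_sum {ι : Type*} (s : Finset ι) (f : ι → List A → ℕ) (x : List A) :
    deletionSum (fun l => ∑ i ∈ s, f i l) x = ∑ i ∈ s, deletionSum (f i) x := by
  induction x generalizing f with
  | nil => simp [deletionSum]
  | cons a x ih => simp [deletionSum, ih, Finset.sum_add_distrib]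

end DeletionSum

/-- `buildingsAux n x` counts the orders in which a word `x` of length `n` can be built by
inserting letters so that all intermediate words have no two equal consecutive letters. -/
def buildingsAux : ℕ → List (Fin 4) → ℕ
  | 0, _ => 1
  | n + 1, x => if x.IsChain (· ≠ ·) then deletionSum (buildingsAux n) x else 0

/-- The number of proper buildings of a word over four letters. -/
def buildings (x : List (Fin 4)) : ℕ := buildingsAux x.length x

theorem buildings_nil : buildings [] = 1 := rfl

theorem buildings_of_isChain {x : List (Fin 4)} (hx : x.IsChain (· ≠ ·)) (h : x ≠ []) :
    buildings x = deletionSum buildings x := by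
  obtain ⟨n, hn⟩ : ∃ n, x.length = n + 1 :=
    Nat.exists_eq_succ_of_ne_zero (by simpa using h)
  rw [buildings, hn, buildingsAux, if_pos hx]
  refine deletionSum_congr fun l hl => ?_
  rw [buildings, show l.length = n by omega]

theorem buildings_of_not_isChain {x : List (Fin 4)} (hx : ¬ x.IsChain (· ≠ ·)) :
    buildings x = 0 := by
  obtain ⟨n, hn⟩ : ∃ n, x.length = n + 1 :=
    Nat.exists_eq_succ_of_ne_zero (by rintro h; simp_all)
  rw [buildings, hn, buildingsAux, if_neg hx]

theorem isChain_of_append_cons {x y : List (Fin 4)} {a : Fin 4}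
    (h : (x ++ a :: y).IsChain (· ≠ ·)) :
    x.IsChain (· ≠ ·) ∧ y.IsChain (· ≠ ·) ∧ x.getLast? ≠ some a ∧ y.head? ≠ some a := by
  rw [List.isChain_append, List.isChain_cons] at h
  obtain ⟨h1, ⟨h2, h3⟩, h4⟩ := h
  refine ⟨h1, h3, fun h => h4 a h a (by simp) rfl, fun h => h2 a h rfl⟩

theorem isChain_append_cons_iff {x y : List (Fin 4)} {a : Fin 4}
    (hx : x.IsChain (· ≠ ·)) (hy : y.IsChain (· ≠ ·)) :
    (x ++ a :: y).IsChain (· ≠ ·) ↔ x.getLast? ≠ some a ∧ y.head? ≠ some a := by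
  refine ⟨fun h => (isChain_of_append_cons h).2.2, fun ⟨h1, h2⟩ => ?_⟩
  rw [List.isChain_append, List.isChain_cons]
  refine ⟨hx, ⟨?_, hy⟩, ?_⟩
  · rintro b hb rfl; exact h2 hb
  · rintro b hb c hc rfl
    simp at hc; subst hc; exact h1 hb

/-- Deleting letters on the left of `a`: the only way in which a conflict at `a` can disappear is
by deleting the last letter before `a`. -/
theorem deletionSum_left {x y : List (Fin 4)} (a : Fin 4)
    (hx : x.IsChain (· ≠ ·)) (hy : y.IsChain (· ≠ ·)) :
    deletionSum (fun l => buildings (l ++ a :: y)) x =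
      (if (x ++ a :: y).IsChain (· ≠ ·) then
        deletionSum (fun l => buildings (l ++ a :: y)) x else 0) +
      (if x.getLast? = some a then buildings (x ++ y) else 0) := by
  by_cases h : (x ++ a :: y).IsChain (· ≠ ·)
  · rw [if_pos h, if_neg (isChain_of_append_cons h).2.2.1, add_zero]
  rw [if_neg h, zero_add]
  by_cases hl : x.getLast? = some a
  · rw [if_pos hl]
    obtain ⟨x', rfl⟩ := List.getLast?_eq_some_iff.1 hl
    rw [deletionSum_append]
    have : (fun l => buildings (l ++ [a] ++ a :: y)) = fun _ => 0 := by
      funext l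
      refine buildings_of_not_isChain fun hc => ?_
      exact (isChain_of_append_cons hc).2.2.1 (by simp)
    rw [this, deletionSum_zero]
    simp [deletionSum]
  · rw [if_neg hl]
    have hr : y.head? = some a := by
      by_contra hr
      exact h ((isChain_append_cons_iff hx hy).2 ⟨hl, hr⟩)
    have : (fun l => buildings (l ++ a :: y)) = fun _ => 0 := by
      funext l
      refine buildings_of_not_isChain fun hc => ?_
      exact (isChain_of_append_cons hc).2.2.2 hr
    rw [this, deletionSum_zero]

theorem deletionSum_right {x y : List (Fin 4)} (a : Fin 4)
    (hx : x.IsChain (· ≠ ·)) (hy : y.IsChain (· ≠ ·)) :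
    deletionSum (fun l => buildings (x ++ a :: l)) y =
      (if (x ++ a :: y).IsChain (· ≠ ·) then
        deletionSum (fun l => buildings (x ++ a :: l)) y else 0) +
      (if y.head? = some a then buildings (x ++ y) else 0) := by
  by_cases h : (x ++ a :: y).IsChain (· ≠ ·)
  · rw [if_pos h, if_neg (isChain_of_append_cons h).2.2.2, add_zero]
  rw [if_neg h, zero_add]
  by_cases hl : y.head? = some a
  · rw [if_pos hl]
    obtain ⟨y', rfl⟩ := List.head?_eq_some_iff.1 hl
    have : (fun l => buildings (x ++ a :: a :: l)) = fun _ => 0 := by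
      funext l
      refine buildings_of_not_isChain fun hc => ?_
      exact (isChain_of_append_cons hc).2.2.2 (by simp)
    simp [deletionSum, this, deletionSum_zero]
  · rw [if_neg hl]
    have hr : x.getLast? = some a := by
      by_contra hr
      exact h ((isChain_append_cons_iff hx hy).2 ⟨hr, hl⟩)
    have : (fun l => buildings (x ++ a :: l)) = fun _ => 0 := by
      funext l
      refine buildings_of_not_isChain fun hc => ?_
      exact (isChain_of_append_cons hc).2.2.1 hr
    rw [this, deletionSum_zero]

/-- The letter inserted last lies to the left of `a`, is `a` itself, or lies to the right of `a`. -/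
theorem buildings_append_cons {x y : List (Fin 4)} (a : Fin 4) :
    buildings (x ++ a :: y) = if (x ++ a :: y).IsChain (· ≠ ·) then
      deletionSum (fun l => buildings (l ++ a :: y)) x + buildings (x ++ y) +
        deletionSum (fun l => buildings (x ++ a :: l)) y else 0 := by
  split_ifs with h
  · rw [buildings_of_isChain h (by simp), deletionSum_append]
    simp only [deletionSum]
    ring
  · exact buildings_of_not_isChain h

/-- `0` for the empty word and `1` for the others. -/
def occupied (x : List (Fin 4)) : ℕ := if x = [] then 0 else 1

theorem sum_ite_getLast? (x : List (Fin 4)) (c : ℕ) :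
    ∑ a, (if x.getLast? = some a then c else 0) = occupied x * c := by
  rcases List.eq_nil_or_concat x with rfl | ⟨x', b, rfl⟩
  · simp [occupied]
  · simp [occupied]

theorem sum_ite_head? (x : List (Fin 4)) (c : ℕ) :
    ∑ a, (if x.head? = some a then c else 0) = occupied x * c := by
  rcases x with _ | ⟨b, x⟩
  · simp [occupied]
  · simp [occupied]

/-- If `x ++ y` is proper, the last letter of `x` and the first of `y` differ, so each nonempty side
excludes its own value of `a`. Otherwise both sides vanish. -/
theorem sum_ite_isChain {x y : List (Fin 4)}
    (hx : x.IsChain (· ≠ ·)) (hy : y.IsChain (· ≠ ·)) :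
    ∑ a, (if (x ++ a :: y).IsChain (· ≠ ·) then buildings (x ++ y) else 0) +
      (occupied x + occupied y) * buildings (x ++ y) = 4 * buildings (x ++ y) := by
  by_cases h : (x ++ y).IsChain (· ≠ ·)
  · have key : ∀ a, (if (x ++ a :: y).IsChain (· ≠ ·) then buildings (x ++ y) else 0) +
        ((if x.getLast? = some a then buildings (x ++ y) else 0) +
          if y.head? = some a then buildings (x ++ y) else 0) = buildings (x ++ y) := by
      intro a
      have := isChain_append_cons_iff (a := a) hx hy
      by_cases h1 : x.getLast? = some a
      · have h2 : y.head? ≠ some a := fun h2 =>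
          (List.isChain_append.1 h).2.2 a h1 a h2 rfl
        rw [if_neg (by rw [this]; simp [h1]), if_pos h1, if_neg h2]; simp
      · by_cases h2 : y.head? = some a
        · rw [if_neg (by rw [this]; simp [h2]), if_neg h1, if_pos h2]; simp
        · rw [if_pos (this.2 ⟨h1, h2⟩), if_neg h1, if_neg h2]; simp
    have := Finset.sum_congr rfl fun a (_ : a ∈ Finset.univ) => key a
    rw [Finset.sum_add_distrib, Finset.sum_add_distrib, sum_ite_getLast?, sum_ite_head?,
      ← add_mul] at this
    simpa using this
  · simp [buildings_of_not_isChain h]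

/-- Each nonempty side loses `buildings (x ++ y)` twice: once for the excluded value of `a`, once
for the conflict that a deletion next to `a` removes. With four letters and both sides nonempty,
this cancels the last term exactly. -/
theorem sum_buildings_recursion {x y : List (Fin 4)}
    (hx : x.IsChain (· ≠ ·)) (hy : y.IsChain (· ≠ ·)) :
    ∑ a, buildings (x ++ a :: y) + 2 * (occupied x + occupied y) * buildings (x ++ y) =
      deletionSum (fun l => ∑ a, buildings (l ++ a :: y)) x +
      deletionSum (fun l => ∑ a, buildings (x ++ a :: l)) y + 4 * buildings (x ++ y) := by
  rw [deletionSum_sum, deletionSum_sum, ← sum_ite_isChain hx hy,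
    Finset.sum_congr rfl fun a _ => deletionSum_left a hx hy,
    Finset.sum_congr rfl fun a _ => deletionSum_right a hx hy,
    Finset.sum_add_distrib, Finset.sum_add_distrib, sum_ite_getLast?, sum_ite_head?]
  have : ∑ a, buildings (x ++ a :: y) =
      ∑ a, (if (x ++ a :: y).IsChain (· ≠ ·) then
        deletionSum (fun l => buildings (l ++ a :: y)) x else 0) +
      ∑ a, (if (x ++ a :: y).IsChain (· ≠ ·) then
        deletionSum (fun l => buildings (x ++ a :: l)) y else 0) +
      ∑ a, (if (x ++ a :: y).IsChain (· ≠ ·) then buildings (x ++ y) else 0) := by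
    rw [← Finset.sum_add_distrib, ← Finset.sum_add_distrib]
    refine Finset.sum_congr rfl fun a _ => ?_
    rw [buildings_append_cons]
    split_ifs <;> ring
  rw [this]
  ring

/-- By induction on the total length, the recursion turns into Pascal's rule for the binomial
coefficient; empty words supply the boundary cases. -/
theorem sum_buildings (x y : List (Fin 4)) :
    ∑ a, buildings (x ++ a :: y) =
      2 * (x.length + y.length + 2).choose (x.length + 1) * buildings x * buildings y := by
  induction hn : x.length + y.length using Nat.strong_induction_on generalizing x y with
  | _ n ih =>
  subst hn
  by_cases hx : x.IsChain (· ≠ ·)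
  swap
  · rw [buildings_of_not_isChain hx, mul_zero, zero_mul]
    refine Finset.sum_eq_zero fun a _ => buildings_of_not_isChain fun h => ?_
    exact hx (isChain_of_append_cons h).1
  by_cases hy : y.IsChain (· ≠ ·)
  swap
  · rw [buildings_of_not_isChain hy, mul_zero]
    refine Finset.sum_eq_zero fun a _ => buildings_of_not_isChain fun h => ?_
    exact hy (isChain_of_append_cons h).2.1
  have hrec := sum_buildings_recursion hx hy
  have hl : deletionSum (fun l => ∑ a, buildings (l ++ a :: y)) x =
      2 * (x.length + y.length + 1).choose x.length * buildings y * deletionSum buildings x := by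
    rw [← deletionSum_mul]
    refine deletionSum_congr fun l hl => ?_
    rw [ih (l.length + y.length) (by omega) l y rfl, hl,
      show l.length + y.length + 2 = x.length + y.length + 1 by omega]
    ring
  have hr : deletionSum (fun l => ∑ a, buildings (x ++ a :: l)) y =
      2 * (x.length + y.length + 1).choose (x.length + 1) * buildings x *
        deletionSum buildings y := by
    rw [← deletionSum_mul]
    refine deletionSum_congr fun l hl => ?_
    rw [ih (x.length + l.length) (by omega) x l rfl,
      show x.length + l.length + 2 = x.length + y.length + 1 by omega]
  rw [hl, hr] at hrec
  rw [show x.length + y.length + 2 = (x.length + y.length + 1) + 1 by omega,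
    Nat.choose_succ_succ]
  rcases eq_or_ne x [] with rfl | hx0 <;> rcases eq_or_ne y [] with rfl | hy0
  · simp [deletionSum, occupied, buildings_nil] at hrec ⊢
    omega
  · rw [← buildings_of_isChain hy hy0] at hrec
    simp [deletionSum, occupied, buildings_nil, hy0] at hrec ⊢
    linarith
  · rw [← buildings_of_isChain hx hx0] at hrec
    simp [deletionSum, occupied, buildings_nil, hx0] at hrec ⊢
    linarith
  · rw [← buildings_of_isChain hx hx0, ← buildings_of_isChain hy hy0] at hrec
    simp only [occupied, hx0, hy0, if_false] at hrec
    linarith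

/-! ### The law of the 1-dependent 4-colouring. -/

section Construction

open scoped NNReal ENNReal Nat

/-- The probability of a word in the 1-dependent 4-colouring of `ℤ`. -/
noncomputable def wordProb (x : List (Fin 4)) : ℝ≥0 :=
  buildings x / (2 ^ x.length * (x.length + 1)!)

theorem wordProb_nil : wordProb [] = 1 := by simp [wordProb, buildings_nil]

/-- The factorials absorb the binomial coefficient of `sum_buildings`, and the power of 2 its factor
2. An empty `x` or `y` gives consistency; the general case says that words separated by one place
are independent. -/
theorem sum_wordProb (x y : List (Fin 4)) :
    ∑ a, wordProb (x ++ a :: y) = wordProb x * wordProb y := by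
  have h := sum_buildings x y
  have hc := Nat.add_choose_mul_factorial_mul_factorial (x.length + 1) (y.length + 1)
  rw [← Nat.choose_symm_add] at hc
  rw [show x.length + 1 + (y.length + 1) = x.length + y.length + 2 by ring] at hc
  simp only [wordProb, List.length_append, List.length_cons]
  rw [← Finset.sum_div, ← Nat.cast_sum, h,
    show x.length + (y.length + 1) + 1 = x.length + y.length + 2 by ring, ← hc,
    div_mul_div_comm]
  have h1 : ((x.length + 1)! : ℝ≥0) ≠ 0 := by exact_mod_cast Nat.factorial_ne_zero _
  have h2 : ((y.length + 1)! : ℝ≥0) ≠ 0 := by exact_mod_cast Nat.factorial_ne_zero _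
  have h3 : ((x.length + y.length + 2).choose (x.length + 1) : ℝ≥0) ≠ 0 := by
    exact_mod_cast (Nat.choose_pos (by omega)).ne'
  push_cast
  field_simp
  ring

theorem sum_wordProb_cons (x : List (Fin 4)) : ∑ a, wordProb (a :: x) = wordProb x := by
  simpa [wordProb_nil] using sum_wordProb [] x

theorem sum_wordProb_concat (x : List (Fin 4)) : ∑ a, wordProb (x ++ [a]) = wordProb x := by
  simpa [wordProb_nil] using sum_wordProb x []

section Cylinder

variable {A : Type*}

/-- The set of sequences in which the word `x` is seen from position `i` onwards. -/
def cyl : ℤ → List A → Set (ℤ → A)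
  | _, [] => Set.univ
  | i, a :: x => (fun ω => ω i) ⁻¹' {a} ∩ cyl (i + 1) x

theorem cyl_append (i : ℤ) (x y : List A) :
    cyl i (x ++ y) = cyl i x ∩ cyl (i + x.length) y := by
  induction x generalizing i with
  | nil => simp [cyl]
  | cons a x ih =>
    simp only [List.cons_append, cyl, ih, List.length_cons, Set.inter_assoc]
    push_cast
    rw [add_right_comm, add_assoc]

theorem mem_cyl {i : ℤ} {x : List A} {ω : ℤ → A} :
    ω ∈ cyl i x ↔ ∀ (j : ℕ) (h : j < x.length), ω (i + j) = x[j] := by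
  induction x generalizing i with
  | nil => simp [cyl]
  | cons a x ih =>
    simp only [cyl, Set.mem_inter_iff, ih, Set.mem_preimage, Set.mem_singleton_iff]
    constructor
    · rintro ⟨h1, h2⟩ (_ | j) hj
      · simpa using h1
      · simpa [add_assoc, add_comm, add_left_comm] using h2 j (by simpa using hj)
    · intro h
      refine ⟨by have := h 0 (by simp); simpa using this, fun j hj => ?_⟩
      have := h (j + 1) (by simpa using hj)
      simpa [add_assoc, add_comm, add_left_comm] using this

theorem measurableSet_cyl [MeasurableSpace A] [MeasurableSingletonClass A] (i : ℤ) (x : List A) :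
    MeasurableSet (cyl i x) := by
  induction x generalizing i with
  | nil => exact MeasurableSet.univ
  | cons a x ih => exact (measurable_pi_apply i (measurableSet_singleton a)).inter (ih _)

theorem isClopen_cyl [TopologicalSpace A] [DiscreteTopology A] (i : ℤ) (x : List A) :
    IsClopen (cyl i x) := by
  induction x generalizing i with
  | nil => exact isClopen_univ
  | cons a x ih => exact ((isClopen_discrete {a}).preimage (continuous_apply i)).inter (ih _)

theorem sum_measure_inter_fiber [MeasurableSpace A] [MeasurableSingletonClass A] [Fintype A]
    (μ : Measure (ℤ → A)) (i : ℤ) {s : Set (ℤ → A)} (hs : MeasurableSet s) :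
    ∑ a, μ ((fun ω => ω i) ⁻¹' {a} ∩ s) = μ s := by
  have := sum_measure_preimage_singleton (μ := μ.restrict s) (Finset.univ : Finset A)
    (f := fun ω : ℤ → A => ω i) fun a _ => measurable_pi_apply i (measurableSet_singleton a)
  simp only [Finset.coe_univ, Set.preimage_univ, Measure.restrict_apply_univ] at this
  rw [← this]
  exact Finset.sum_congr rfl fun a _ => (Measure.restrict_apply' hs).symm

theorem sum_measure_cyl_cons [MeasurableSpace A] [MeasurableSingletonClass A] [Fintype A]
    (μ : Measure (ℤ → A)) (i : ℤ) (x : List A) :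
    ∑ a, μ (cyl i (a :: x)) = μ (cyl (i + 1) x) :=
  sum_measure_inter_fiber μ i (measurableSet_cyl _ _)

theorem sum_measure_cyl_append_cons [MeasurableSpace A] [MeasurableSingletonClass A] [Fintype A]
    (μ : Measure (ℤ → A)) (i : ℤ) (x y : List A) :
    ∑ a, μ (cyl i (x ++ a :: y)) = μ (cyl i x ∩ cyl (i + x.length + 1) y) := by
  rw [← sum_measure_inter_fiber μ (i + x.length)
    ((measurableSet_cyl i x).inter (measurableSet_cyl _ y))]
  refine Finset.sum_congr rfl fun a _ => ?_
  rw [cyl_append, cyl, Set.inter_left_comm]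

theorem sum_measure_cyl_concat [MeasurableSpace A] [MeasurableSingletonClass A] [Fintype A]
    (μ : Measure (ℤ → A)) (i : ℤ) (x : List A) :
    ∑ a, μ (cyl i (x ++ [a])) = μ (cyl i x) := by
  rw [sum_measure_cyl_append_cons]
  simp [cyl]

end Cylinder

/-- Under `μ`, words of length `n` at position `i` have the law `wordProb`. -/
def HasWordLaw (μ : Measure (ℤ → Fin 4)) (i : ℤ) (n : ℕ) : Prop :=
  ∀ x : List (Fin 4), x.length = n → μ (cyl i x) = wordProb x

theorem HasWordLaw.tail {μ : Measure (ℤ → Fin 4)} {i : ℤ} {n : ℕ} (h : HasWordLaw μ i (n + 1)) :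
    HasWordLaw μ (i + 1) n := by
  intro x hx
  rw [← sum_measure_cyl_cons, ← sum_wordProb_cons]
  push_cast
  exact Finset.sum_congr rfl fun a _ => h _ (by simp [hx])

theorem HasWordLaw.init {μ : Measure (ℤ → Fin 4)} {i : ℤ} {n : ℕ} (h : HasWordLaw μ i (n + 1)) :
    HasWordLaw μ i n := by
  intro x hx
  rw [← sum_measure_cyl_concat, ← sum_wordProb_concat]
  push_cast
  exact Finset.sum_congr rfl fun a _ => h _ (by simp [hx])

theorem HasWordLaw.mono {μ : Measure (ℤ → Fin 4)} {i j : ℤ} {m n : ℕ} (h : HasWordLaw μ i m)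
    (hi : i ≤ j) (hj : j + n ≤ i + m) : HasWordLaw μ j n := by
  induction m generalizing i with
  | zero =>
    obtain rfl : i = j := by omega
    obtain rfl : n = 0 := by omega
    exact h
  | succ m ih =>
    rcases hi.eq_or_lt with rfl | hi
    · rcases (show n ≤ m + 1 by omega).eq_or_lt with rfl | hn
      · exact h
      · exact ih h.init le_rfl (by omega)
    · exact ih h.tail (by omega) (by push_cast at hj; omega)

theorem exists_hasWordLaw (i : ℤ) (n : ℕ) : ∃ μ : Measure (ℤ → Fin 4), HasWordLaw μ i n := by
  classical
  -- The sequence `e x` spells `x` from place `i` on; its values elsewhere are irrelevant, as only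
  -- cylinders on the `n` places from `i` are tested.
  let e : List (Fin 4) → ℤ → Fin 4 := fun x k => x.getD (k - i).toNat 0
  refine ⟨∑ z : Fin n → Fin 4, (wordProb (List.ofFn z) : ℝ≥0∞) • Measure.dirac (e (List.ofFn z)),
    ?_⟩
  rintro x rfl
  have key : ∀ z : Fin x.length → Fin 4, e (List.ofFn z) ∈ cyl i x ↔ z = x.get := by
    intro z
    rw [mem_cyl]
    constructor
    · intro h
      funext j
      have := h j j.2
      simpa [e] using this
    · rintro rfl j hj
      simp [e, hj]
  rw [Measure.finsetSum_apply]
  simp only [Measure.smul_apply, Measure.dirac_apply' _ (measurableSet_cyl i x), Set.indicator_apply,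
    key, Pi.one_apply, smul_eq_mul, mul_ite, mul_one, mul_zero, Finset.sum_ite_eq',
    Finset.mem_univ, if_true, List.ofFn_get]

theorem HasWordLaw.isProbabilityMeasure {μ : Measure (ℤ → Fin 4)} {i : ℤ} {n : ℕ}
    (h : HasWordLaw μ i n) : IsProbabilityMeasure μ := by
  have := h.mono (j := i) (n := 0) le_rfl (by simp) [] rfl
  exact ⟨by simpa [cyl, wordProb_nil] using this⟩

/-- Existence of the law of the 1-dependent 4-colouring, by weak compactness. -/
theorem exists_forall_measure_cyl :
    ∃ ν : Measure (ℤ → Fin 4), IsProbabilityMeasure ν ∧ ∀ i x, ν (cyl i x) = wordProb x := by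
  choose μ hμ using fun n : ℕ => exists_hasWordLaw (-n) (2 * n)
  let p : ℕ → ProbabilityMeasure (ℤ → Fin 4) := fun n => ⟨μ n, (hμ n).isProbabilityMeasure⟩
  let F : Ultrafilter ℕ := Filter.hyperfilter ℕ
  -- Cylinders are clopen, so their probabilities converge along the ultrafilter, and each is
  -- eventually constant once the window from `-n` to `n - 1` contains the cylinder.
  obtain ⟨ν, -, hν⟩ := isCompact_univ.ultrafilter_le_nhds' (F.map p) Filter.univ_mem
  have hlim : Filter.Tendsto p F (nhds ν) := hν
  refine ⟨ν, inferInstance, fun i x => ?_⟩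
  have h1 := ProbabilityMeasure.tendsto_measure_of_null_frontier_of_tendsto' hlim
    (E := cyl i x) (by simp [(isClopen_cyl i x).frontier_eq])
  refine tendsto_nhds_unique h1 (tendsto_const_nhds.congr' ?_)
  have h2 : ∀ᶠ n : ℕ in F, i.natAbs + x.length ≤ n :=
    (Filter.eventually_ge_atTop _).filter_mono Nat.hyperfilter_le_atTop
  filter_upwards [h2] with n hn
  exact ((hμ n).mono (by omega) (by push_cast; omega) x rfl).symm

end Construction

/-! ### Reduction of laws and independence to cylinders. -/

section Window

variable {A : Type*}

theorem window_eq_iff {ω : ℤ → A} {i : ℤ} {n : ℕ} {y : Fin n → A} :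
    window ω i n = y ↔ ω ∈ cyl (i + 1) (List.ofFn y) := by
  rw [mem_cyl]
  constructor
  · rintro rfl j hj
    simp [window]
  · intro h
    funext j
    simpa [window] using h j (by simp)

theorem preimage_window_singleton (i : ℤ) {n : ℕ} (y : Fin n → A) :
    (fun ω => window ω i n) ⁻¹' {y} = cyl (i + 1) (List.ofFn y) := by
  ext ω
  exact window_eq_iff

theorem window_apply_toNat (ω : ℤ → A) {i k : ℤ} {n : ℕ} (h1 : i < k) (h2 : k ≤ i + n) :
    window ω i n ⟨(k - i - 1).toNat, by omega⟩ = ω k := by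
  simp only [window]
  congr 1
  omega

theorem measurable_window [MeasurableSpace A] (i : ℤ) (n : ℕ) :
    Measurable fun ω : ℤ → A => window ω i n :=
  measurable_pi_lambda _ fun _ => measurable_pi_apply _

theorem exists_window_finset (I : Finset ℤ) : ∃ (i : ℤ) (n : ℕ), ∀ k ∈ I, i < k ∧ k ≤ i + n := by
  obtain ⟨a, ha⟩ := I.bddBelow
  obtain ⟨b, hb⟩ := I.bddAbove
  refine ⟨a - 1, (b - a + 1).toNat, fun k hk => ?_⟩
  have := ha hk
  have := hb hk
  omega

variable [MeasurableSpace A] [MeasurableSingletonClass A] [Finite A]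

theorem ext_of_cyl {μ ν : Measure (ℤ → A)} [IsFiniteMeasure μ] [IsFiniteMeasure ν]
    (h : ∀ i x, μ (cyl i x) = ν (cyl i x)) : μ = ν := by
  refine IsProjectiveLimit.unique (P := fun I => ν.map I.restrict) (fun I => ?_) fun I => rfl
  obtain ⟨i, n, hI⟩ := exists_window_finset I
  let g : (Fin n → A) → I → A := fun y k =>
    y ⟨((k : ℤ) - i - 1).toNat, by have := hI k k.2; omega⟩
  have hg : Measurable g := measurable_pi_lambda _ fun _ => measurable_pi_apply _
  have hr : (I.restrict : (ℤ → A) → I → A) = g ∘ fun ω => window ω i n := by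
    funext ω k
    exact (window_apply_toNat ω (hI k k.2).1 (hI k k.2).2).symm
  beta_reduce
  rw [hr, ← Measure.map_map hg (measurable_window i n),
    ← Measure.map_map hg (measurable_window i n)]
  congr 1
  refine Measure.ext_of_singleton fun y => ?_
  rw [Measure.map_apply (measurable_window i n) (measurableSet_singleton y),
    Measure.map_apply (measurable_window i n) (measurableSet_singleton y),
    preimage_window_singleton, h]

theorem indepFun_window_of_cyl {μ : Measure (ℤ → A)} [IsProbabilityMeasure μ] {i j : ℤ} {m n : ℕ}
    (h : ∀ x y : List A, x.length = m → y.length = n →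
      μ (cyl (i + 1) x ∩ cyl (j + 1) y) = μ (cyl (i + 1) x) * μ (cyl (j + 1) y)) :
    IndepFun (fun ω => window ω i m) (fun ω => window ω j n) μ := by
  have hm := measurable_window (A := A) i m
  have hn := measurable_window (A := A) j n
  rw [indepFun_iff_map_prod_eq_prod_map_map hm.aemeasurable hn.aemeasurable]
  refine Measure.ext_of_singleton fun ⟨x, y⟩ => ?_
  rw [Measure.map_apply (hm.prodMk hn) (measurableSet_singleton _), ← Set.singleton_prod_singleton,
    Measure.prod_prod, Set.mk_preimage_prod,
    Measure.map_apply hm (measurableSet_singleton _), Measure.map_apply hn (measurableSet_singleton _),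
    preimage_window_singleton, preimage_window_singleton]
  exact h _ _ (by simp) (by simp)

/-- Independence of the two sides of a gap can be tested on words next to the gap. -/
theorem indepFun_past_future {μ : Measure (ℤ → A)} [IsProbabilityMeasure μ] (t s : ℤ)
    (h : ∀ x y : List A,
      μ (cyl (t - x.length) x ∩ cyl s y) = μ (cyl (t - x.length) x) * μ (cyl s y)) :
    IndepFun (fun ω (j : {j : ℤ // j < t}) => ω j) (fun ω (j : {j : ℤ // s ≤ j}) => ω j) μ := by
  refine IndepFun.process_indepFun_process (X := fun (j : {j : ℤ // j < t}) (ω : ℤ → A) => ω j)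
    (Y := fun (j : {j : ℤ // s ≤ j}) (ω : ℤ → A) => ω j)
    (fun j => measurable_pi_apply _) (fun j => measurable_pi_apply _) fun I J => ?_
  obtain ⟨i, m, hI⟩ := exists_window_finset (I.map (Function.Embedding.subtype _))
  obtain ⟨k, n, hJ⟩ := exists_window_finset (J.map (Function.Embedding.subtype _))
  -- Both windows are replaced by ones that abut the gap: one ends at `t - 1`, the other begins at
  -- `s`.
  have hI' : ∀ j ∈ I, t - 1 - ((t - i).toNat : ℕ) < (j : ℤ) ∧
      (j : ℤ) ≤ t - 1 - ((t - i).toNat : ℕ) + ((t - i).toNat : ℕ) := by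
    intro j hj
    have h1 := hI j (Finset.mem_map_of_mem _ hj)
    have h2 := j.2
    omega
  have hJ' : ∀ j ∈ J, s - 1 < (j : ℤ) ∧ (j : ℤ) ≤ s - 1 + ((k + n - s + 1).toNat : ℕ) := by
    intro j hj
    have h1 := hJ j (Finset.mem_map_of_mem _ hj)
    have h2 := j.2
    omega
  generalize (t - i).toNat = m' at hI'
  generalize (k + n - s + 1).toNat = n' at hJ'
  have hw := indepFun_window_of_cyl (μ := μ) (i := t - 1 - m') (j := s - 1) (m := m') (n := n') (by
    rintro x y rfl rfl
    convert h x y using 3 <;> (congr 1; ring))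
  let f : (Fin m' → A) → I → A := fun y j =>
    y ⟨((j : ℤ) - (t - 1 - m') - 1).toNat, by have := hI' j j.2; omega⟩
  let g : (Fin n' → A) → J → A := fun y j =>
    y ⟨((j : ℤ) - (s - 1) - 1).toNat, by have := hJ' j j.2; omega⟩
  have hf : Measurable f := measurable_pi_lambda _ fun _ => measurable_pi_apply _
  have hg : Measurable g := measurable_pi_lambda _ fun _ => measurable_pi_apply _
  convert hw.comp hf hg using 1
  · funext ω j
    exact (window_apply_toNat ω (hI' j j.2).1 (hI' j j.2).2).symm
  · funext ω j
    exact (window_apply_toNat ω (hJ' j j.2).1 (hJ' j j.2).2).symm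

end Window

/-- The shift map on bi-infinite sequences. -/
def translate {A : Type*} (ω : ℤ → A) : ℤ → A := fun i => ω (i + 1)

theorem measurable_translate {A : Type*} [MeasurableSpace A] :
    Measurable (translate : (ℤ → A) → ℤ → A) :=
  measurable_pi_lambda _ fun _ => measurable_pi_apply _

theorem preimage_translate_cyl {A : Type*} (i : ℤ) (x : List A) :
    translate ⁻¹' cyl i x = cyl (i + 1) x := by
  ext ω
  simp only [Set.mem_preimage, mem_cyl, translate]
  simp only [add_right_comm]

/-- There is a stationary 1-dependent proper 4-colouring of `ℤ`. -/
theorem exists_coloring : ∃ ν : Measure (ℤ → Fin 4), IsProbabilityMeasure ν ∧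
    MeasurePreserving translate ν ν ∧
    (∀ t : ℤ, IndepFun (fun ω (j : {j : ℤ // j < t}) => ω j)
      (fun ω (j : {j : ℤ // t + 1 ≤ j}) => ω j) ν) ∧
    ∀ i : ℤ, ∀ᵐ ω ∂ν, ω i ≠ ω (i + 1) := by
  obtain ⟨ν, hν, hcyl⟩ := exists_forall_measure_cyl
  refine ⟨ν, hν, ⟨measurable_translate, ?_⟩, fun t => ?_, fun i => ?_⟩
  · have := Measure.isProbabilityMeasure_map (μ := ν)
      (measurable_translate (A := Fin 4)).aemeasurable
    refine ext_of_cyl fun i x => ?_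
    rw [Measure.map_apply measurable_translate (measurableSet_cyl i x), preimage_translate_cyl,
      hcyl, hcyl]
  · refine indepFun_past_future t (t + 1) fun x y => ?_
    have := sum_measure_cyl_append_cons ν (t - x.length) x y
    rw [sub_add_cancel] at this
    rw [← this]
    simp only [hcyl]
    rw [← ENNReal.coe_mul, ← sum_wordProb]
    push_cast
    rfl
  · have h : ∀ a : Fin 4, ν (cyl i [a, a]) = 0 := by
      intro a
      rw [hcyl, wordProb, buildings_of_not_isChain (by simp)]
      simp
    rw [ae_iff]
    refine measure_mono_null (t := ⋃ a, cyl i [a, a]) (fun ω hω => ?_) (measure_iUnion_null h)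
    rw [Set.mem_iUnion]
    refine ⟨ω i, ?_⟩
    simp only [Set.mem_ofPred_eq, not_not] at hω
    simp [cyl, ← hω]

/-- Coordinatewise independence in a finite product space. -/
theorem indepFun_pi_of_forall {ι : Type*} [Fintype ι] {α β γ : ι → Type*}
    [∀ i, MeasurableSpace (α i)] [∀ i, MeasurableSpace (β i)] [∀ i, MeasurableSpace (γ i)]
    (μ : ∀ i, Measure (α i)) [∀ i, IsProbabilityMeasure (μ i)]
    {f : ∀ i, α i → β i} {g : ∀ i, α i → γ i} (hf : ∀ i, Measurable (f i))
    (hg : ∀ i, Measurable (g i)) (h : ∀ i, IndepFun (f i) (g i) (μ i)) :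
    IndepFun (fun ω i => f i (ω i)) (fun ω i => g i (ω i)) (Measure.pi μ) := by
  have hF : Measurable fun (ω : ∀ i, α i) i => f i (ω i) :=
    measurable_pi_lambda _ fun i => (hf i).comp (measurable_pi_apply i)
  have hG : Measurable fun (ω : ∀ i, α i) i => g i (ω i) :=
    measurable_pi_lambda _ fun i => (hg i).comp (measurable_pi_apply i)
  rw [IndepFun_iff_Indep]
  refine IndepSets.indep hF.comap_le hG.comap_le
    (isPiSystem_pi.comap _) (isPiSystem_pi.comap _)
    (by rw [← generateFrom_pi, MeasurableSpace.comap_generateFrom]; rfl)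
    (by rw [← generateFrom_pi, MeasurableSpace.comap_generateFrom]; rfl) ?_
  rw [IndepSets_iff]
  rintro _ _ ⟨_, ⟨s, hs, rfl⟩, rfl⟩ ⟨_, ⟨t, ht, rfl⟩, rfl⟩
  have h1 : (fun (ω : ∀ i, α i) i => f i (ω i)) ⁻¹' Set.univ.pi s =
      Set.univ.pi fun i => f i ⁻¹' s i := by ext; simp
  have h2 : (fun (ω : ∀ i, α i) i => g i (ω i)) ⁻¹' Set.univ.pi t =
      Set.univ.pi fun i => g i ⁻¹' t i := by ext; simp
  rw [h1, h2, ← Set.pi_inter_distrib, Measure.pi_pi, Measure.pi_pi, Measure.pi_pi,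
    ← Finset.prod_mul_distrib]
  exact Finset.prod_congr rfl fun i _ =>
    (h i).measure_inter_preimage_eq_mul _ _ (hs i trivial) (ht i trivial)

/-! ### Interleaving independent colourings. -/

/-- The rows of the interleaved colourings: for each `d < N` there are `d + 1` rows, which
together colour the points of `ℤ` by sending `i` to the place `i / (d + 1)` of row
`i % (d + 1)`. -/
abbrev Row (N : ℕ) : Type := (d : Fin N) × Fin (d + 1)

/-- The place of a row at `i : ℤ`. -/
def rowAt {N : ℕ} (d : Fin N) (i : ℤ) : Row N :=
  ⟨d, ⟨(i % ((d : ℤ) + 1)).toNat, by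
    have := Int.emod_nonneg i (b := (d : ℤ) + 1) (by omega)
    have := Int.emod_lt_of_pos i (b := (d : ℤ) + 1) (by omega)
    omega⟩⟩

/-- The interleaved colouring of `ℤ`. -/
def interleave {N : ℕ} (ω : Row N → ℤ → Fin 4) (i : ℤ) : Fin N → Fin 4 :=
  fun d => ω (rowAt d i) (i / ((d : ℤ) + 1))

theorem measurable_interleave {N : ℕ} :
    Measurable (interleave : (Row N → ℤ → Fin 4) → ℤ → Fin N → Fin 4) :=
  measurable_pi_lambda _ fun _ => measurable_pi_lambda _ fun _ =>
    (measurable_pi_apply _).comp (measurable_pi_apply _)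

theorem rowAt_add {N : ℕ} (d : Fin N) (i : ℤ) : rowAt d (i + (d + 1)) = rowAt d i := by
  simp [rowAt]

/-- With `d = j - i - 1`, the points `i` and `j` occupy consecutive places of the same row. -/
theorem interleave_ne {N : ℕ} {ω : Row N → ℤ → Fin 4} (hω : ∀ e i, ω e i ≠ ω e (i + 1))
    {i j : ℤ} (hij : i < j) (hj : j ≤ i + N) : interleave ω i ≠ interleave ω j := by
  intro h
  let d : Fin N := ⟨(j - i - 1).toNat, by omega⟩
  have hd : j = i + ((d : ℤ) + 1) := by simp only [d]; omega
  have h' := congr_fun h d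
  simp only [interleave] at h'
  rw [hd, rowAt_add, Int.add_ediv_of_dvd_right dvd_rfl, Int.ediv_self (by omega)] at h'
  exact hω _ _ h'

/-- The map on rows that corresponds to the shift of `ℤ`. -/
def rowShift (N : ℕ) : Row N ≃ Row N := Equiv.sigmaCongrRight fun d => finRotate (d + 1)

/-- The map on families of rows that corresponds to the shift of `ℤ`. -/
def interleaveShift {N : ℕ} (ω : Row N → ℤ → Fin 4) : Row N → ℤ → Fin 4 :=
  fun e => if (e.2 : ℕ) = e.1 then translate (ω (rowShift N e)) else ω (rowShift N e)

/-- Passing from `i` to `i + 1` moves to the next row; only from the last row, where the residue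
wraps to 0, does the place also advance. -/
theorem interleave_interleaveShift {N : ℕ} (ω : Row N → ℤ → Fin 4) (i : ℤ) :
    interleave (interleaveShift ω) i = interleave ω (i + 1) := by
  funext d
  have h0 : (0 : ℤ) < (d : ℤ) + 1 := by omega
  have h1 := Int.emod_nonneg i h0.ne'
  have h2 := Int.emod_lt_of_pos i h0
  have h3 := Int.mul_ediv_add_emod i ((d : ℤ) + 1)
  simp only [interleave, interleaveShift]
  by_cases h : (((rowAt d i).2 : Fin _) : ℕ) = (rowAt d i).1
  · rw [if_pos h]
    have hr : i % ((d : ℤ) + 1) = d := by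
      simp only [rowAt] at h
      omega
    obtain ⟨hq, hm⟩ := (Int.ediv_emod_unique (a := i + 1) (r := 0)
      (q := i / ((d : ℤ) + 1) + 1) h0).2 ⟨by rw [mul_add]; omega, by omega, by omega⟩
    rw [hq, translate]
    congr 1
    simp only [rowShift, rowAt, Equiv.sigmaCongrRight_apply]
    congr 1
    apply Fin.ext
    rw [coe_finRotate, if_pos (Fin.ext (by simp only [Fin.val_last]; omega))]
    simp only [hm, Int.toNat_zero]
  · rw [if_neg h]
    have hr : i % ((d : ℤ) + 1) < d := by
      simp only [rowAt] at h
      omega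
    obtain ⟨hq, hm⟩ := (Int.ediv_emod_unique (a := i + 1) (r := i % ((d : ℤ) + 1) + 1)
      (q := i / ((d : ℤ) + 1)) h0).2 ⟨by omega, by omega, by omega⟩
    rw [hq]
    congr 1
    simp only [rowShift, rowAt, Equiv.sigmaCongrRight_apply]
    congr 1
    apply Fin.ext
    rw [coe_finRotate]
    simp only [hm, Fin.ext_iff, Fin.val_last]
    rw [if_neg (by omega)]
    omega

theorem measurePreserving_interleaveShift {N : ℕ} {ν : Measure (ℤ → Fin 4)}
    [IsProbabilityMeasure ν] (hν : MeasurePreserving translate ν ν) :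
    MeasurePreserving (interleaveShift (N := N)) (Measure.pi fun _ => ν)
      (Measure.pi fun _ => ν) := by
  have h1 := measurePreserving_piCongrLeft (α := fun _ : Row N => ℤ → Fin 4) (fun _ => ν)
    (rowShift N).symm
  have h2 := measurePreserving_pi (fun _ : Row N => ν) (fun _ => ν)
    (f := fun e => if (e.2 : ℕ) = e.1 then translate else id) (fun e => by
      split_ifs
      · exact hν
      · exact MeasurePreserving.id ν)
  convert h2.comp h1 using 1
  funext ω e
  simp only [interleaveShift, Function.comp_apply]
  have : (MeasurableEquiv.piCongrLeft (fun _ : Row N => ℤ → Fin 4) (rowShift N).symm) ω e =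
      ω (rowShift N e) := by
    conv_lhs => rw [← (rowShift N).symm_apply_apply e]
    exact Equiv.piCongrLeft_apply_apply _ _ _ _
  rw [this]
  split_ifs <;> rfl

/-- The first place of a row that corresponds to a position `> i` of `ℤ`. -/
def threshold {N : ℕ} (i : ℤ) (e : Row N) : ℤ := (i - (e.2 : ℕ)) / ((e.1 : ℕ) + 1 : ℤ) + 1

theorem lt_threshold {N : ℕ} {i j : ℤ} (d : Fin N) (h : j ≤ i) :
    j / ((d : ℤ) + 1) < threshold i (rowAt d j) := by
  have h0 : (0 : ℤ) < (d : ℤ) + 1 := by omega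
  have h1 := Int.emod_nonneg j h0.ne'
  have h3 := Int.mul_ediv_add_emod j ((d : ℤ) + 1)
  simp only [threshold, rowAt]
  rw [Int.lt_add_one_iff, Int.le_ediv_iff_mul_le h0, Int.toNat_of_nonneg h1, mul_comm]
  omega

/-- Consecutive places of a row are at most `N` apart in `ℤ`: one such step reaches the threshold,
and a second skips the place that 1-dependence requires to be left out. -/
theorem threshold_le {N : ℕ} {i j : ℤ} (d : Fin N) (h : i + 2 * N ≤ j) :
    threshold i (rowAt d j) + 1 ≤ j / ((d : ℤ) + 1) := by
  have h0 : (0 : ℤ) < (d : ℤ) + 1 := by omega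
  have h1 := Int.emod_nonneg j h0.ne'
  have h3 := Int.mul_ediv_add_emod j ((d : ℤ) + 1)
  have hd := d.2
  simp only [threshold, rowAt]
  rw [Int.toNat_of_nonneg h1]
  have : (i - j % ((d : ℤ) + 1)) / ((d : ℤ) + 1) < j / ((d : ℤ) + 1) - 1 := by
    rw [Int.ediv_lt_iff_lt_mul h0, sub_mul, mul_comm]
    omega
  omega

/-! ### Selecting sparse points by a local rule. -/

/-- Greedy selection of places with pairwise distances greater than `N`: the colours are processed
in increasing order, and after `c` steps all colours below `c` are done. -/
def selected (N : ℕ) (z : ℤ → ℕ) : ℕ → ℤ → Prop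
  | 0, _ => False
  | c + 1, i => selected N z c i ∨ z i = c ∧ ∀ j, |j - i| ≤ N → ¬ selected N z c j

theorem selected_mono {N : ℕ} {z : ℤ → ℕ} {c d : ℕ} (h : c ≤ d) {i : ℤ}
    (hi : selected N z c i) : selected N z d i := by
  induction h with
  | refl => exact hi
  | step _ ih => exact Or.inl ih

/-- If no point near `i` is selected before the turn of the colour of `i`, then `i` itself is. -/
theorem exists_selected {N : ℕ} {z : ℤ → ℕ} {K : ℕ} (hz : ∀ i, z i < K) (i : ℤ) :
    ∃ j, |j - i| ≤ N ∧ selected N z K j := by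
  by_cases h : ∃ j, |j - i| ≤ N ∧ selected N z (z i) j
  · obtain ⟨j, hj, hs⟩ := h
    exact ⟨j, hj, selected_mono (hz i).le hs⟩
  · push Not at h
    exact ⟨i, by simp, selected_mono (hz i) (Or.inr ⟨rfl, h⟩)⟩

theorem not_selected_of_near {N : ℕ} {z : ℤ → ℕ} (hz : ∀ i j : ℤ, i < j → j ≤ i + N → z i ≠ z j)
    {i j : ℤ} (hij : i < j) (hj : j ≤ i + N) (c : ℕ) (h1 : selected N z c i) :
    ¬ selected N z c j := by
  induction c with
  | zero => exact h1.elim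
  | succ c ih =>
    rintro (h2 | ⟨h2, h3⟩)
    · rcases h1 with h1 | ⟨h1, h4⟩
      · exact ih h1 h2
      · exact h4 j (by rw [abs_le]; omega) h2
    · rcases h1 with h1 | ⟨h1, h4⟩
      · exact h3 i (by rw [abs_le]; omega) h1
      · exact hz i j hij hj (h1.trans h2.symm)

/-- Every step of the selection looks `N` further. -/
theorem selected_congr {N : ℕ} {z z' : ℤ → ℕ} (c : ℕ) {i : ℤ}
    (h : ∀ j, |j - i| ≤ N * c → z j = z' j) : selected N z c i ↔ selected N z' c i := by
  induction c generalizing i with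
  | zero => rfl
  | succ c ih =>
    push_cast at h
    have h0 : (0 : ℤ) ≤ N * c := by positivity
    simp only [selected]
    rw [ih fun j hj => h j (by linarith), h i (by simp)]
    have : ∀ j, |j - i| ≤ N → (selected N z c j ↔ selected N z' c j) := fun j hj =>
      ih fun k hk => h k (by
        have := abs_sub_le k j i
        linarith)
    exact or_congr Iff.rfl (and_congr Iff.rfl
      (forall_congr' fun j => imp_congr_right fun hj => not_congr (this j hj)))

theorem selected_translate {N : ℕ} {z : ℤ → ℕ} (c : ℕ) (i : ℤ) :
    selected N (translate z) c i ↔ selected N z c (i + 1) := by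
  induction c generalizing i with
  | zero => rfl
  | succ c ih =>
    simp only [selected, ih]
    refine or_congr Iff.rfl (and_congr Iff.rfl ⟨fun h j hj => ?_, fun h j hj => ?_⟩)
    · have := h (j - 1) (by rwa [sub_sub, add_comm 1 i])
      rwa [sub_add_cancel] at this
    · exact h (j + 1) (by rwa [add_sub_add_right_eq_sub])

/-! ### Filling the gaps. -/

/-- The distance from `i - 1` back to the last point of `M` before `i`. -/
noncomputable def backward (M : ℤ → Prop) (i : ℤ) : ℕ := sInf {s : ℕ | M (i - 1 - s)}

/-- The distance from `i` to the next point of `M`. -/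
noncomputable def forward (M : ℤ → Prop) (i : ℤ) : ℕ := sInf {s : ℕ | M (i + s)}

/-- Fill the gaps between the points of `M`, a gap of length `t` with a segment of `x t`. -/
noncomputable def fill {A : Type*} (x : ℕ → ℤ → A) (M : ℤ → Prop) (i : ℤ) : A :=
  x (backward M i + forward M i + 1) (backward M i + 1)

theorem sInf_congr_of_le {S T : Set ℕ} {B : ℕ} (hS : ∃ s ∈ S, s ≤ B)
    (h : ∀ s ≤ B, s ∈ S ↔ s ∈ T) : sInf S = sInf T := by
  obtain ⟨s, hs, hB⟩ := hS
  have h1 : sInf S ≤ B := (Nat.sInf_le hs).trans hB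
  have h2 : sInf S ∈ T := (h _ h1).1 (Nat.sInf_mem ⟨s, hs⟩)
  have h3 : sInf T ≤ sInf S := Nat.sInf_le h2
  exact le_antisymm (Nat.sInf_le ((h _ (h3.trans h1)).2 (Nat.sInf_mem ⟨_, h2⟩))) h3

theorem fill_congr {A : Type*} (x : ℕ → ℤ → A) {M M' : ℤ → Prop} {N : ℕ} {i : ℤ}
    (hM : ∀ i : ℤ, ∃ j, |j - i| ≤ N ∧ M j)
    (h : ∀ j, |j - i| ≤ 2 * N + 1 → (M j ↔ M' j)) : fill x M i = fill x M' i := by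
  have h1 : backward M i = backward M' i := by
    obtain ⟨j, hj, hs⟩ := hM (i - 1 - N)
    rw [abs_le] at hj
    refine sInf_congr_of_le (B := 2 * N) ⟨(i - 1 - j).toNat, ?_, by omega⟩ fun s hs => ?_
    · rw [Set.mem_ofPred_eq]
      convert hs using 1
      omega
    · exact h _ (by rw [abs_le]; omega)
  have h2 : forward M i = forward M' i := by
    obtain ⟨j, hj, hs⟩ := hM (i + N)
    rw [abs_le] at hj
    refine sInf_congr_of_le (B := 2 * N) ⟨(j - i).toNat, ?_, by omega⟩ fun s hs => ?_
    · rw [Set.mem_ofPred_eq]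
      convert hs using 1
      omega
    · exact h _ (by rw [abs_le]; omega)
  simp only [fill, h1, h2]

theorem fill_translate {A : Type*} (x : ℕ → ℤ → A) (M : ℤ → Prop) (i : ℤ) :
    fill x (fun j => M (j + 1)) i = fill x M (i + 1) := by
  have h1 : backward (fun j => M (j + 1)) i = backward M (i + 1) := by
    simp only [backward]
    congr! 4
    ring
  have h2 : forward (fun j => M (j + 1)) i = forward M (i + 1) := by
    simp only [forward]
    congr! 4
    ring
  simp only [fill, h1, h2]

theorem fill_eq {A : Type*} (x : ℕ → ℤ → A) {M : ℤ → Prop} {a b k : ℤ} (ha : M a) (hb : M b)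
    (h : ∀ j, a < j → j < b → ¬ M j) (hak : a < k) (hkb : k ≤ b) :
    fill x M k = x (b - a).toNat (k - a) := by
  have h1 : backward M k = (k - 1 - a).toNat := by
    refine IsLeast.csInf_eq ⟨?_, fun s hs => ?_⟩
    · rw [Set.mem_ofPred_eq]
      convert ha using 1
      omega
    · by_contra hlt
      exact h _ (by omega) (by omega) hs
  have h2 : forward M k = (b - k).toNat := by
    refine IsLeast.csInf_eq ⟨?_, fun s hs => ?_⟩
    · rw [Set.mem_ofPred_eq]
      convert hb using 1
      omega
    · by_contra hlt
      exact h _ (by omega) (by omega) hs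
  simp only [fill, h1, h2]
  congr 1 <;> omega

theorem exists_adjacent {M : ℤ → Prop} {N : ℕ} (hM : ∀ i : ℤ, ∃ j, |j - i| ≤ N ∧ M j) (i : ℤ) :
    ∃ a b, M a ∧ M b ∧ a ≤ i ∧ i < b ∧ ∀ j, a < j → j < b → ¬ M j := by
  have hp : ∃ s : ℕ, M (i - s) := by
    obtain ⟨j, hj, hs⟩ := hM (i - N)
    rw [abs_le] at hj
    refine ⟨(i - j).toNat, ?_⟩
    convert hs using 1
    omega
  have hn : ∃ s : ℕ, M (i + 1 + s) := by
    obtain ⟨j, hj, hs⟩ := hM (i + 1 + N)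
    rw [abs_le] at hj
    refine ⟨(j - i - 1).toNat, ?_⟩
    convert hs using 1
    omega
  classical
  refine ⟨i - Nat.find hp, i + 1 + Nat.find hn, Nat.find_spec hp, Nat.find_spec hn, by omega,
    by omega, fun j h1 h2 hj => ?_⟩
  rcases le_or_gt j i with hji | hji
  · refine Nat.find_min hp (m := (i - j).toNat) (by omega) ?_
    convert hj using 1
    omega
  · refine Nat.find_min hn (m := (j - i - 1).toNat) (by omega) ?_
    convert hj using 1
    omega

/-- Gaps exceed `N ≥ m`, so a window meets at most two of them. Past the boundary it reads the start
of `w`, which is also how the segment of the first gap continues; hence it is a window of that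
single element of the shift. -/
theorem fill_mem_shift {q m N : ℕ} {W : Set (Fin m → Fin q)} {w : Fin m → Fin q}
    {x : ℕ → ℤ → Fin q} (hN : m ≤ N)
    (hx : ∀ t : ℕ, N < t → x t ∈ shift q m W ∧ window (x t) 0 m = w ∧ window (x t) t m = w)
    {M : ℤ → Prop} (hM : ∀ i : ℤ, ∃ j, |j - i| ≤ N ∧ M j)
    (hsep : ∀ i j : ℤ, i < j → j ≤ i + N → M i → ¬ M j) : fill x M ∈ shift q m W := by
  intro i
  obtain ⟨a, b, ha, hb, hai, hib, hab⟩ := exists_adjacent hM i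
  obtain ⟨b', c, hb', hc, hbb', hbc, hbc'⟩ := exists_adjacent hM b
  obtain rfl : b' = b := by
    by_contra hne
    exact hbc' b (by omega) hbc hb
  have hgap : N < (b' - a).toNat := by
    by_contra h
    exact hsep a b' (by omega) (by omega) ha hb
  have hgap' : N < (c - b').toNat := by
    by_contra h
    exact hsep b' c (by omega) (by omega) hb hc
  obtain ⟨hxS, hx0, hxt⟩ := hx _ hgap
  obtain ⟨-, hx0', -⟩ := hx _ hgap'
  have : window (fill x M) i m = window (x (b' - a).toNat) (i - a) m := by
    funext j
    simp only [window]
    rcases le_or_gt (i + 1 + (j : ℕ)) b' with hj | hj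
    · rw [fill_eq x ha hb hab (by omega) hj]
      congr 1
      ring
    · have hjm := j.2
      rw [fill_eq x hb hc hbc' hj (by omega)]
      have e1 := congr_fun hx0' ⟨(i + j - b').toNat, by omega⟩
      have e2 := congr_fun hxt ⟨(i + j - b').toNat, by omega⟩
      simp only [window] at e1 e2
      rw [show i + 1 + (j : ℕ) - b' = 0 + 1 + ((i + j - b').toNat : ℕ) by omega, e1, ← e2]
      congr 1
      omega
  rw [this]
  exact hxS _

/-! ### Recurrence times. -/

theorem window_splice {A : Type*} {x y : ℤ → A} {m : ℕ} {t : ℤ}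
    (h : window x t m = window y 0 m) :
    (∀ i ≤ t, window (fun j => if j ≤ t then x j else y (j - t)) i m = window x i m) ∧
    ∀ i ≥ t, window (fun j => if j ≤ t then x j else y (j - t)) i m = window y (i - t) m := by
  constructor
  · intro i hi
    funext j
    simp only [window]
    split_ifs with hj
    · rfl
    · have hjm := j.2
      have := congr_fun h ⟨(i + j - t).toNat, by omega⟩
      simp only [window] at this
      convert this.symm using 2 <;> omega
  · intro i hi
    funext j
    simp only [window]
    rw [if_neg (by omega)]
    congr 1
    ring

theorem add_mem_recurrenceTimes {q m : ℕ} {W : Set (Fin m → Fin q)} {w : Fin m → Fin q} {s t : ℕ}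
    (hs : s ∈ recurrenceTimes q m W w) (ht : t ∈ recurrenceTimes q m W w) :
    s + t ∈ recurrenceTimes q m W w := by
  obtain ⟨hs, x, hx, hx0, hxs⟩ := hs
  obtain ⟨ht, y, hy, hy0, hyt⟩ := ht
  obtain ⟨h1, h2⟩ := window_splice (hxs.trans hy0.symm)
  refine ⟨by omega, _, fun i => ?_, (h1 0 (by omega)).trans hx0,
    (h2 (s + t : ℕ) (by push_cast; omega)).trans ?_⟩
  · rcases le_total i s with hi | hi
    · rw [h1 i hi]; exact hx i
    · rw [h2 i hi]; exact hy _
  · rw [← hyt]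
    congr 1
    push_cast
    ring

/-- Splicing makes T(w) closed under addition, and a numerical semigroup of gcd 1 contains all large
integers; the generated submonoid adds only 0. -/
theorem exists_forall_mem_recurrenceTimes {q m : ℕ} {W : Set (Fin m → Fin q)} {w : Fin m → Fin q}
    (h : Nat.setGcd (recurrenceTimes q m W w) = 1) :
    ∃ N, ∀ t > N, t ∈ recurrenceTimes q m W w := by
  obtain ⟨N, hN⟩ := Nat.exists_mem_closure_of_ge (recurrenceTimes q m W w)
  refine ⟨N, fun t ht => ?_⟩
  have hmem := hN t ht.le (by rw [h]; exact one_dvd t)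
  have : t = 0 ∨ t ∈ recurrenceTimes q m W w := by
    refine AddSubmonoid.closure_induction (motive := fun t _ => t = 0 ∨ t ∈ recurrenceTimes q m W w)
      (fun _ h => Or.inr h) (Or.inl rfl) ?_ hmem
    rintro a b - - (rfl | ha) (rfl | hb)
    · exact Or.inl rfl
    · exact Or.inr (by simpa using hb)
    · exact Or.inr (by simpa using ha)
    · exact Or.inr (add_mem_recurrenceTimes ha hb)
  exact this.resolve_left (by omega)

theorem measurable_of_dependsOn_finset {ι C D : Type*} [Finite C] [Nonempty D] [MeasurableSpace C]
    [MeasurableSingletonClass C] [MeasurableSpace D] {f : (ι → C) → D} (I : Finset ι)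
    (h : ∀ x y : ι → C, (∀ i ∈ I, x i = y i) → f x = f y) : Measurable f := by
  have hd : DependsOn f (I : Set ι) := fun x y hxy => h x y hxy
  obtain ⟨g, rfl⟩ := dependsOn_iff_exists_comp.1 hd
  exact (measurable_of_finite g).comp (measurable_pi_lambda _ fun _ => measurable_pi_apply _)

/-! ### The local rule and its range of dependence. -/

section Rule

variable {q : ℕ} (N : ℕ) (x : ℕ → ℤ → Fin q)

/-- The number of colours of the interleaved colouring. -/
def colorCard : ℕ := Fintype.card (Fin N → Fin 4)

/-- The local rule that turns the interleaved colouring into a sequence over `Fin q`. -/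
noncomputable def rule (c : ℤ → Fin N → Fin 4) (i : ℤ) : Fin q :=
  fill x (selected N (fun j => (Fintype.equivFin _ (c j) : ℕ)) (colorCard N)) i

/-- The radius of the local rule. -/
def radius : ℕ := 2 * N + 1 + N * colorCard N

theorem exists_selected_colorCard (c : ℤ → Fin N → Fin 4) (i : ℤ) :
    ∃ j, |j - i| ≤ N ∧ selected N (fun j => (Fintype.equivFin _ (c j) : ℕ)) (colorCard N) j :=
  exists_selected (fun j => (Fintype.equivFin _ (c j)).2) i

theorem rule_congr {c c' : ℤ → Fin N → Fin 4} {i : ℤ}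
    (h : ∀ j, |j - i| ≤ radius N → c j = c' j) : rule N x c i = rule N x c' i := by
  refine fill_congr x (exists_selected_colorCard N c) fun j hj => selected_congr _ fun k hk => ?_
  rw [h k]
  have := abs_sub_le k j i
  simp only [radius]
  push_cast
  linarith

theorem rule_translate (c : ℤ → Fin N → Fin 4) (i : ℤ) :
    rule N x (translate c) i = rule N x c (i + 1) := by
  simp only [rule]
  rw [← fill_translate]
  congr 1
  funext j
  exact propext (selected_translate (z := fun j => (Fintype.equivFin _ (c j) : ℕ)) _ j)

theorem measurable_rule (i : ℤ) : Measurable fun c => rule N x c i := by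
  have : Nonempty (Fin q) := ⟨x 0 0⟩
  refine measurable_of_dependsOn_finset (Finset.Icc (i - radius N) (i + radius N))
    fun c c' h => rule_congr N x fun j hj => h j ?_
  rw [abs_le] at hj
  rw [Finset.mem_Icc]
  omega

theorem rule_mem_shift {m : ℕ} {W : Set (Fin m → Fin q)} {w : Fin m → Fin q} (hN : m ≤ N)
    (hx : ∀ t : ℕ, N < t → x t ∈ shift q m W ∧ window (x t) 0 m = w ∧ window (x t) t m = w)
    {c : ℤ → Fin N → Fin 4} (hc : ∀ i j : ℤ, i < j → j ≤ i + N → c i ≠ c j) :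
    rule N x c ∈ shift q m W :=
  fill_mem_shift hN hx (exists_selected_colorCard N c) fun _ _ hij hj h =>
    not_selected_of_near (fun i j hij hj h => hc i j hij hj
      ((Fintype.equivFin _).injective (Fin.ext h))) hij hj _ h

variable {N}

/-- The part of a family of rows on a set of places, extended by the colour `0`. -/
noncomputable def extendRows (s : Row N → Set ℤ) (p : ∀ e, s e → Fin 4) : Row N → ℤ → Fin 4 :=
  open Classical in fun e n => if h : n ∈ s e then p e ⟨n, h⟩ else 0

theorem measurable_extendRows (s : Row N → Set ℤ) : Measurable (extendRows s) := by
  refine measurable_pi_lambda _ fun e => measurable_pi_lambda _ fun n => ?_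
  by_cases h : n ∈ s e
  · simp only [extendRows, dif_pos h]
    exact (measurable_pi_apply _).comp (measurable_pi_apply _)
  · simp only [extendRows, dif_neg h]
    exact measurable_const

theorem measurable_rule_interleave (i : ℤ) :
    Measurable fun ω : Row N → ℤ → Fin 4 => rule N x (interleave ω) i :=
  (measurable_rule N x i).comp measurable_interleave

theorem rule_interleave_extendRows (s : Row N → Set ℤ) (ω : Row N → ℤ → Fin 4) (i : ℤ)
    (h : ∀ (d : Fin N) (j : ℤ), |j - i| ≤ radius N → j / ((d : ℤ) + 1) ∈ s (rowAt d j)) :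
    rule N x (interleave (extendRows s fun e n => ω e n)) i = rule N x (interleave ω) i := by
  refine rule_congr N x fun j hj => ?_
  funext d
  simp only [interleave, extendRows]
  rw [dif_pos (h d j hj)]

theorem isKDependent_rule {ν : Measure (ℤ → Fin 4)} [IsProbabilityMeasure ν]
    (hν : ∀ t : ℤ, IndepFun (fun ω (j : {j : ℤ // j < t}) => ω j)
      (fun ω (j : {j : ℤ // t + 1 ≤ j}) => ω j) ν) :
    IsKDependent (2 * radius N + 2 * N)
      (fun i (ω : Row N → ℤ → Fin 4) => rule N x (interleave ω) i) (Measure.pi fun _ => ν) := by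
  intro i
  -- The past reads positions up to `i + radius N - 1`, the future positions from `i + radius N + 2
  -- * N` on. In each row they are separated by the place `T e`.
  let T : Row N → ℤ := threshold (i + radius N - 1)
  have hind := indepFun_pi_of_forall (ι := Row N) (fun _ => ν)
    (f := fun e ω (j : {j : ℤ // j < T e}) => ω j)
    (g := fun e ω (j : {j : ℤ // T e + 1 ≤ j}) => ω j)
    (fun e => measurable_pi_lambda _ fun _ => measurable_pi_apply _)
    (fun e => measurable_pi_lambda _ fun _ => measurable_pi_apply _) fun e => hν (T e)
  have hG : Measurable fun (p : ∀ e, {j : ℤ // j < T e} → Fin 4) (j : {j : ℤ // j < i}) =>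
      rule N x (interleave (extendRows (fun e => {j | j < T e}) p)) j :=
    measurable_pi_lambda _ fun j =>
      (measurable_rule_interleave x j).comp (measurable_extendRows fun e => {j | j < T e})
  have hH : Measurable fun (p : ∀ e, {j : ℤ // T e + 1 ≤ j} → Fin 4)
      (j : {j : ℤ // i + (2 * radius N + 2 * N : ℕ) ≤ j}) =>
      rule N x (interleave (extendRows (fun e => {j | T e + 1 ≤ j}) p)) j :=
    measurable_pi_lambda _ fun j =>
      (measurable_rule_interleave x j).comp (measurable_extendRows fun e => {j | T e + 1 ≤ j})
  convert hind.comp hG hH using 1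
  · funext ω j
    refine (rule_interleave_extendRows x (fun e => {j | j < T e}) ω j fun d k hk => ?_).symm
    have hj := j.2
    rw [abs_le] at hk
    exact lt_threshold d (by omega)
  · funext ω j
    refine (rule_interleave_extendRows x (fun e => {j | T e + 1 ≤ j}) ω j fun d k hk => ?_).symm
    have hj := j.2
    rw [abs_le] at hk
    push_cast at hj
    exact threshold_le d (by omega)

end Rule

theorem exists_finitely_dependent {q m : ℕ} {W : Set (Fin m → Fin q)} (h : NonLattice q m W) :
    ∃ (k : ℕ) (Ω : Type) (_ : MeasurableSpace Ω) (P : Measure Ω) (_ : IsProbabilityMeasure P)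
      (X : ℤ → Ω → Fin q),
      (∀ i, Measurable (X i)) ∧ IsStationary X P ∧ IsKDependent k X P ∧
      ∀ᵐ ω ∂P, (fun i => X i ω) ∈ shift q m W := by
  obtain ⟨w, -, hw⟩ := h
  obtain ⟨N₀, hN₀⟩ := exists_forall_mem_recurrenceTimes hw
  -- Gaps longer than `N` are recurrence times since `N ≥ N₀`, and exceed the window length since `N
  -- ≥ m`. For `t ≤ N` the sequence `x t` is a dummy, because no such gap occurs.
  let N := max N₀ m
  have hx : ∀ t : ℕ, ∃ x : ℤ → Fin q,
      N < t → x ∈ shift q m W ∧ window x 0 m = w ∧ window x t m = w := by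
    intro t
    obtain ⟨-, x₀, -⟩ := hN₀ (N₀ + 1) (by omega)
    by_cases ht : N < t
    · obtain ⟨-, x, hx⟩ := hN₀ t (lt_of_le_of_lt (le_max_left _ _) ht)
      exact ⟨x, fun _ => hx⟩
    · exact ⟨x₀, fun h => absurd h ht⟩
  choose x hx using hx
  obtain ⟨ν, hν, hstat, hind, hne⟩ := exists_coloring
  refine ⟨2 * radius N + 2 * N, Row N → ℤ → Fin 4, inferInstance, Measure.pi fun _ => ν,
    inferInstance, fun i ω => rule N x (interleave ω) i, measurable_rule_interleave x, ?_,
    isKDependent_rule x hind, ?_⟩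
  · have hσ := measurePreserving_interleaveShift (N := N) hstat
    have hX : Measurable fun (ω : Row N → ℤ → Fin 4) (i : ℤ) => rule N x (interleave ω) i :=
      measurable_pi_lambda _ fun i => measurable_rule_interleave x i
    have hshift : (fun (ω : Row N → ℤ → Fin 4) (i : ℤ) => rule N x (interleave ω) (i + 1)) =
        (fun ω i => rule N x (interleave ω) i) ∘ interleaveShift := by
      funext ω i
      rw [← rule_translate, Function.comp_apply]
      congr 1
      funext j
      exact (interleave_interleaveShift ω j).symm
    refine ⟨hX.aemeasurable, ?_, ?_⟩
    · exact (measurable_pi_lambda _ fun i => measurable_rule_interleave x (i + 1)).aemeasurable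
    · rw [hshift, ← Measure.map_map hX hσ.measurable, hσ.map_eq]
  · have : ∀ᵐ ω ∂(Measure.pi fun _ : Row N => ν), ∀ e i, ω e i ≠ ω e (i + 1) := by
      rw [ae_all_iff]
      intro e
      exact (measurePreserving_eval (fun _ : Row N => ν) e).quasiMeasurePreserving.ae
        (ae_all_iff.2 hne)
    filter_upwards [this] with ω hω
    exact rule_mem_shift N x (le_max_right _ _) hx fun i j => interleave_ne hω

/-! ### A Ramsey theorem for segments. -/

section Ramsey

variable {C : Type*} [Finite C]

theorem exists_eventually_eq_ultrafilter (F : Ultrafilter ℕ) (f : ℕ → C) :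
    ∃ a, ∀ᶠ n in (F : Filter ℕ), f n = a := by
  exact Ultrafilter.eventually_exists_iff.1 (Filter.Eventually.of_forall fun n => ⟨f n, rfl⟩)

/-- A limit of `f` along the hyperfilter. -/
noncomputable def ultralimit (f : ℕ → C) : C :=
  (exists_eventually_eq_ultrafilter (Filter.hyperfilter ℕ) f).choose

theorem eventually_eq_ultralimit (f : ℕ → C) :
    ∀ᶠ n in (Filter.hyperfilter ℕ : Filter ℕ), f n = ultralimit f :=
  (exists_eventually_eq_ultrafilter (Filter.hyperfilter ℕ) f).choose_spec

/-- Iterated limits of a colouring of words; the first letters are the limit variables. -/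
noncomputable def iteratedLimit (c : List ℕ → C) : ℕ → List ℕ → C
  | 0, l => c l
  | s + 1, l => ultralimit fun n => iteratedLimit c s (n :: l)

/-- For every finite colouring of the lists of length `r` there are arbitrarily long strictly
decreasing lists of which all segments of length `r` have the same colour. -/
theorem exists_list_segments_eq (c : List ℕ → C) (r n : ℕ) :
    ∃ L : List ℕ, L.length = n ∧ L.Pairwise (· > ·) ∧
      (∀ s ≤ r, r - s ≤ n → iteratedLimit c s (L.take (r - s)) = iteratedLimit c r []) ∧
      ∀ k, k + r ≤ n → c ((L.drop k).take r) = iteratedLimit c r [] := by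
  induction n with
  | zero =>
    refine ⟨[], rfl, List.Pairwise.nil, fun s hs hr => ?_, fun k hk => ?_⟩
    · obtain rfl : s = r := by omega
      simp
    · obtain rfl : r = 0 := by omega
      simp [iteratedLimit]
  | succ n ih =>
    obtain ⟨L, hL, hdec, hlim, hseg⟩ := ih
    -- A new first letter `a` is taken large and such that finitely many limits are attained at `a`;
    -- this keeps every prefix shorter than `r` generic.
    have hev : ∀ᶠ a in (Filter.hyperfilter ℕ : Filter ℕ), (∀ b ∈ L, b < a) ∧
        ∀ s < r, iteratedLimit c s (a :: L.take (r - (s + 1))) =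
          iteratedLimit c (s + 1) (L.take (r - (s + 1))) := by
      refine Filter.Eventually.and ?_ ?_
      · have : ∀ᶠ a in Filter.atTop, ∀ b ∈ L.toFinset, b < a :=
          (Filter.eventually_all_finset _).2 fun b _ => Filter.eventually_gt_atTop b
        simpa using this.filter_mono Nat.hyperfilter_le_atTop
      · have : ∀ᶠ a in (Filter.hyperfilter ℕ : Filter ℕ), ∀ s ∈ Finset.range r,
            iteratedLimit c s (a :: L.take (r - (s + 1))) =
              iteratedLimit c (s + 1) (L.take (r - (s + 1))) :=
          (Filter.eventually_all_finset _).2 fun s _ => eventually_eq_ultralimit _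
        simpa using this
    obtain ⟨a, ha, hs⟩ := hev.exists
    have hlim' : ∀ s ≤ r, r - s ≤ n + 1 →
        iteratedLimit c s ((a :: L).take (r - s)) = iteratedLimit c r [] := by
      intro s hsr hn
      rcases hsr.eq_or_lt with rfl | hsr
      · simp
      · rw [show r - s = (r - (s + 1)) + 1 by omega, List.take_succ_cons, hs s hsr,
          hlim (s + 1) hsr (by omega)]
    refine ⟨a :: L, by simp [hL], List.pairwise_cons.2 ⟨ha, hdec⟩, hlim', fun k hk => ?_⟩
    rcases k with _ | k
    · simpa [iteratedLimit] using hlim' 0 (Nat.zero_le r) (by omega)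
    · simpa using hseg k (by omega)

/-- For every finite colouring of the `r`-tuples of natural numbers there are arbitrarily long
injective tuples of which all segments of length `r` have the same colour. -/
theorem exists_injective_segments_eq {r : ℕ} (c : (Fin r → ℕ) → C) (n : ℕ) :
    ∃ (φ : Fin (n + r) → ℕ) (a : C), Function.Injective φ ∧
      ∀ k : Fin n, c (fun j => φ ⟨k + j, by omega⟩) = a := by
  obtain ⟨L, hL, hdec, -, hseg⟩ :=
    exists_list_segments_eq (fun l => c fun j => l.reverse.getD j 0) r (n + r)
  refine ⟨fun j => L.reverse.get (j.cast (by simp [hL])),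
    iteratedLimit (fun l => c fun j => l.reverse.getD j 0) r [], ?_, fun k => ?_⟩
  · have hnd : L.reverse.Nodup :=
      List.nodup_reverse.2 (hdec.imp fun h => (ne_of_lt h).symm)
    exact hnd.injective_get.comp (Fin.cast_injective _)
  · rw [← hseg (n - k) (by omega)]
    congr 1
    funext j
    have hj := j.2
    have hk := k.2
    have hlen : ((L.drop (n - k)).take r).length = r := by simp [hL]
    rw [List.getD_eq_getElem _ _ (by simp [hlen])]
    simp only [List.get_eq_getElem, List.getElem_reverse, List.getElem_take, List.getElem_drop,
      hlen, hL, Fin.val_cast]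
    congr 1
    omega

end Ramsey

/-! ### Block-factors show constant patterns. -/

/-- All injective reindexings of an i.i.d. sequence have the same finite-dimensional laws. -/
theorem measure_preimage_reindex {ι Ω E : Type*} [MeasurableSpace Ω] [MeasurableSpace E]
    {P : Measure Ω} [IsProbabilityMeasure P] {U : ι → Ω → E} (hU : ∀ i, Measurable (U i))
    (hind : iIndepFun U P) {i₀ : ι} (hid : ∀ i, IdentDistrib (U i) (U i₀) P P) {n : ℕ}
    {φ ψ : Fin n → ι} (hφ : φ.Injective) (hψ : ψ.Injective) {s : Set (Fin n → E)}
    (hs : MeasurableSet s) :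
    P ((fun ω j => U (φ j) ω) ⁻¹' s) = P ((fun ω j => U (ψ j) ω) ⁻¹' s) := by
  have key : ∀ {φ : Fin n → ι}, φ.Injective →
      P ((fun ω j => U (φ j) ω) ⁻¹' s) = Measure.pi (fun _ : Fin n => P.map (U i₀)) s := by
    intro φ hφ
    have h1 := (iIndepFun_iff_map_fun_eq_pi_map (fun j => (hU (φ j)).aemeasurable)).1
      (hind.precomp hφ)
    rw [← Measure.map_apply (measurable_pi_lambda _ fun j => hU (φ j)) hs, h1]
    congr 2
    funext j
    exact (hid (φ j)).map_eq
  rw [key hφ, key hψ]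

/-- A block-factor of an i.i.d. sequence with finitely many values is constant on any given
finite window with positive probability. -/
theorem exists_measure_const_ne_zero {C Ω E : Type*} [Finite C] [MeasurableSpace C]
    [MeasurableSingletonClass C] [MeasurableSpace Ω] [MeasurableSpace E]
    {P : Measure Ω} [IsProbabilityMeasure P] {U : ℤ → Ω → E} (hU : ∀ i, Measurable (U i))
    (hind : iIndepFun U P) (hid : ∀ i, IdentDistrib (U i) (U 0) P P) {r : ℕ}
    {f : (Fin r → E) → C} (hf : Measurable f) (n : ℕ) :
    ∃ a : C, P {ω | window (fun i => f (window (fun j => U j ω) i r)) 0 n = fun _ => a} ≠ 0 := by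
  let s : C → Set (Fin (n + r) → E) := fun a =>
    {e | ∀ k : Fin n, f (fun j : Fin r => e ⟨k + j, by omega⟩) = a}
  have hs : ∀ a, MeasurableSet (s a) := by
    intro a
    simp only [s, Set.ofPred_forall]
    refine MeasurableSet.iInter fun k => ?_
    exact (hf.comp (measurable_pi_lambda _ fun j => measurable_pi_apply _))
      (measurableSet_singleton a)
  by_contra! hzero
  -- Ramsey is applied to each outcome separately; the union is countable, so it would be null if
  -- every event were.
  have hcover : (⋃ (p : {φ : Fin (n + r) → ℕ // φ.Injective} × C),
      (fun ω j => U (p.1.1 j) ω) ⁻¹' s p.2) = Set.univ := by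
    refine Set.eq_univ_of_forall fun ω => ?_
    obtain ⟨φ, a, hφ, h⟩ :=
      exists_injective_segments_eq (fun t : Fin r → ℕ => f fun j => U (t j) ω) n
    exact Set.mem_iUnion.2 ⟨(⟨φ, hφ⟩, a), h⟩
  have hnull : P (⋃ (p : {φ : Fin (n + r) → ℕ // φ.Injective} × C),
      (fun ω j => U (p.1.1 j) ω) ⁻¹' s p.2) = 0 := by
    refine measure_iUnion_null fun ⟨⟨φ, hφ⟩, a⟩ => ?_
    -- The offset is 2 because both nested windows, at 0 and at `i`, start one place later.
    have hψ : Function.Injective fun j : Fin (n + r) => (2 + j : ℤ) := fun j k h => by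
      simpa [Fin.ext_iff] using h
    have := measure_preimage_reindex hU hind (φ := fun j => (φ j : ℤ)) hid
      (Nat.cast_injective.comp hφ) hψ (hs a)
    rw [this, ← hzero a]
    congr 1
    ext ω
    simp only [s, Set.mem_preimage, Set.mem_ofPred_eq, funext_iff, window]
    refine forall_congr' fun k => ?_
    have : (fun j : Fin r => U (2 + ((k : ℕ) + (j : ℕ) : ℕ)) ω) =
        fun j : Fin r => U (0 + 1 + (k : ℕ) + 1 + (j : ℕ)) ω := by
      funext j
      congr 1
      push_cast
      ring
    rw [this]
    rfl
  rw [hcover, measure_univ] at hnull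
  exact one_ne_zero hnull

theorem IsBlockFactor.not_ae_mem_shift {q m r : ℕ} {W : Set (Fin m → Fin q)}
    (hW : ∀ a : Fin q, (fun _ : ℤ => a) ∉ shift q m W) {Ω : Type u} [MeasurableSpace Ω]
    {P : Measure Ω} {X : ℤ → Ω → Fin q}
    (hX : IsBlockFactor.{u, v, w} r X P) : ¬ ∀ᵐ ω ∂P, (fun i => X i ω) ∈ shift q m W := by
  intro hmem
  obtain ⟨Ω', _, P', _, E, _, U, f, hU, hind, hid, hf, hlaw⟩ := hX
  obtain ⟨a, ha⟩ := exists_measure_const_ne_zero hU hind hid hf m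
  have hmeas : MeasurableSet {x : ℤ → Fin q | window x 0 m = fun _ => a} :=
    measurable_window 0 m (measurableSet_singleton fun _ => a)
  have hpos : P {ω | window (fun i => X i ω) 0 m = fun _ => a} ≠ 0 := by
    rw [show {ω | window (fun i => X i ω) 0 m = fun _ => a} =
      (fun ω i => X i ω) ⁻¹' {x | window x 0 m = fun _ => a} from rfl,
      hlaw.measure_mem_eq hmeas]
    exact ha
  have hW' : (fun _ => a) ∉ W := fun h => hW a fun _ => h
  have hne : ∀ᵐ ω ∂P, ¬ window (fun i => X i ω) 0 m = fun _ => a := by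
    filter_upwards [hmem] with ω hω h
    exact hW' (h ▸ hω 0)
  rw [ae_iff] at hne
  exact hpos (by simpa only [not_not] using hne)

end SFT

theorem corollary1p6 (q m : ℕ) (W : Set (Fin m → Fin q)) :
    -- a non-lattice shift of finite type admits a stationary finitely dependent process
    (SFT.NonLattice q m W →
      ∃ (k : ℕ) (Ω : Type) (_ : MeasurableSpace Ω) (P : Measure Ω) (_ : IsProbabilityMeasure P)
        (X : ℤ → Ω → Fin q),
        (∀ i, Measurable (X i)) ∧ SFT.IsStationary X P ∧ SFT.IsKDependent k X P ∧
        ∀ᵐ ω ∂P, (fun i => X i ω) ∈ SFT.shift q m W) ∧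
    -- a shift of finite type without constant sequences admits no block-factor
    ((∀ a : Fin q, (fun _ : ℤ => a) ∉ SFT.shift q m W) →
      ∀ (r : ℕ) (Ω : Type u) [MeasurableSpace Ω] (P : Measure Ω) [IsProbabilityMeasure P]
        (X : ℤ → Ω → Fin q), (∀ i, Measurable (X i)) →
        SFT.IsBlockFactor.{u, v, w} r X P →
        ¬ ∀ᵐ ω ∂P, (fun i => X i ω) ∈ SFT.shift q m W) :=
  ⟨SFT.exists_finitely_dependent, fun hW _ _ _ _ _ _ _ hX => hX.not_ae_mem_shift hW⟩
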